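/- **Wasserstein distance between a stochastic neural network and its Gaussian mixture approximation over a finite set of points.** *Notation.* For $\rho\in\{1,2\}$ and probability measures $\mu,\nu$ on a Euclidean space let $\mathbb W_\rho(\mu,\nu)=\inf_\gamma\big(\mathbb E_{(y,y')\sim\gamma}\|y-y'\|^\rho\big)^{1/\rho}\in[0,\infty]$, the infimum being over all couplings $\gamma$ of $\mu$ and $\nu$; $f\#\mu$ is the push-forward of $\mu$ under $f$, and $\|W\|$ is the spectral norm of a matrix $W$. *Network.* Let $K\ge 0$, let $n_0,\dots,n_{K+1}$ be layer widths, and let $\sigma_k:\mathbb R^{n_k}\to\mathbb R^{n_k}$ ($1\le k\le K$) be Lipschitz with constant $L_\sigma$ (for instance the coordinatewise application of an $L_\sigma$-Lipschitz scalar activation). Let the parameters $w_k=(W_k,b_k)\in\mathbb R^{n_{k+1}\times n_k}\times\mathbb R^{n_{k+1}}$, $k=0,\dots,K$, be independent with laws $p_{w_k}$ (arbitrary correlations within a layer are allowed). For input points $\mathcal X=(x_1,\dots,x_D)$, $x_d\in\mathbb R^{n_0}$, put $\zeta_1=L^D_{w_0}(x_1,\dots,x_D)$ and $\zeta_{k+1}=L^D_{w_k}(\sigma_k(\zeta_k))$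 for $1\le k\le K$, where $L^D_w(z_1,\dots,z_D)=(Wz_1+b,\dots,Wz_D+b)$ and where $\sigma_k$ acts on each of the $D$ blocks of $\zeta_k\in\mathbb R^{D n_k}$. Let $p_{nn(\mathcal X)}$ be the law of $\zeta_{K+1}$, i.e. the joint law of the network outputs at the $D$ points. *Approximation.* For $1\le k\le K$ let $R_k$ be a compression operation that turns a measure on $\mathbb R^{Dn_k}$ into a finite mixture $\sum_i\pi_i r_i$ of probability measures, and let $\Delta_{k}\#\sum_i\pi_i r_i:=\sum_i\pi_i\,\Delta_{\mathcal C_{k,i}}\#r_i$ be its signature, where $\mathcal C_{k,i}\subset\mathbb R^{Dn_k}$ are finite nonempty sets and $\Delta_{\mathcal C}$ sends every point to a nearest point of $\mathcal C$ (ties broken by a fixed order of the points of $\mathcal C$); if all $\mathcal C_{k,i}$ equal $\mathcal C_k$, this is the push-forward of the mixture under $\Delta_{\mathcal C_k}$. Let $q_1$ be the law of $\zeta_1$ and, for $1\le k\le K$, $$q_{k+1}=\mathbb E_{z\sim\Delta_k\#R_k(q_k)}\big[L^D_{(\cdot)}(\sigma_k(z))\#p_{w_k}\big],\qquad q_{nn(\mathcal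 X)}=q_{K+1}.$$ *Claim.* Let $\hat{\mathcal S}_k,\hat{\mathbb W}_{R,k},\hat{\mathbb W}_{\Delta,k}\in[0,\infty)$, $1\le k\le K$, satisfy $$D^{1/2}\,\mathbb E_{w_k\sim p_{w_k}}\big[\|W_k\|^\rho\big]^{1/\rho}\le\hat{\mathcal S}_k,\qquad \mathbb W_\rho\big(q_k,R_k(q_k)\big)\le\hat{\mathbb W}_{R,k},\qquad \mathbb W_\rho\big(\sigma_k\#R_k(q_k),\,\sigma_k\#\Delta_k\#R_k(q_k)\big)\le\hat{\mathbb W}_{\Delta,k}.$$ Define $\hat{\mathbb W}_1=0$ and $\hat{\mathbb W}_{k+1}=\hat{\mathcal S}_k\big[L_\sigma\hat{\mathbb W}_k+L_\sigma\hat{\mathbb W}_{R,k}+\hat{\mathbb W}_{\Delta,k}\big]$ for $1\le k\le K$. Then $$\mathbb W_\rho\big(p_{nn(\mathcal X)},q_{nn(\mathcal X)}\big)\le\hat{\mathbb W}_{K+1}.$$ Moreover, if all $p_{w_k}$ are Gaussian, then $q_{nn(\mathcal X)}$ is a mixture of finitely many (possibly degenerate) Gaussian distributions. -/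

import Mathlib

open MeasureTheory ProbabilityTheory
open scoped ENNReal NNReal

noncomputable section

namespace SNN

/-! ### Wasserstein distance -/

/-- The `ρ`-Wasserstein distance: the infimum over all couplings `γ` of `μ` and `ν` of
`(𝔼_{(x, y) ∼ γ} ‖x - y‖ ^ ρ) ^ (1 / ρ)`, as an extended nonnegative real. -/
def wasserstein {E : Type*} [NormedAddCommGroup E] [MeasurableSpace E]
    (ρ : ℝ) (μ ν : Measure E) : ℝ≥0∞ :=
  ⨅ γ ∈ {γ : Measure (E × E) | γ.fst = μ ∧ γ.snd = ν},
    (∫⁻ z, ‖z.1 - z.2‖ₑ ^ ρ ∂γ) ^ (1 / ρ)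

/-! ### Finite mixtures and their signatures -/

/-- A mixture of `M` probability distributions on `E`. -/
structure FinMixture (E : Type*) [MeasurableSpace E] (M : ℕ) where
  weight : Fin M → ℝ≥0
  weight_sum : ∑ i, weight i = 1
  comp : Fin M → ProbabilityMeasure E

/-- The distribution `∑ i, π i • r i` of the mixture. -/
def FinMixture.toMeasure {E : Type*} [MeasurableSpace E] {M : ℕ} (m : FinMixture E M) :
    Measure E :=
  ∑ i, m.weight i • (m.comp i : Measure E)

/-- `μ` is a Gaussian mixture: a mixture of finitely many (possibly degenerate) Gaussians. -/
def IsGaussianMixture {E : Type*} [TopologicalSpace E] [AddCommMonoid E] [Module ℝ E]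
    [MeasurableSpace E] (μ : Measure E) : Prop :=
  ∃ (M : ℕ) (m : FinMixture E M),
    (∀ i, IsGaussian (m.comp i : Measure E)) ∧ μ = m.toMeasure

/-- The signature map `Δ_C` for the locations `C = {c 0, …, c N}`: every point is sent to its
closest location (ties between Voronoi cells go to the least index). -/
def signatureMap {E : Type*} [NormedAddCommGroup E] [MeasurableSpace E] [BorelSpace E]
    (c : ℕ → E) (N : ℕ) : E → E :=
  SimpleFunc.nearestPt c N

/-- The signature `∑ i, π i • (Δ_{C i} # r i)` of a mixture `∑ i, π i • r i`, the component `i`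
having its own locations `C i = {c i 0, …, c i (N i)}`. -/
def FinMixture.signature {E : Type*} [NormedAddCommGroup E] [MeasurableSpace E] [BorelSpace E]
    {M : ℕ} (m : FinMixture E M) (c : Fin M → ℕ → E) (N : Fin M → ℕ) : Measure E :=
  ∑ i, m.weight i • (m.comp i : Measure E).map (signatureMap (c i) (N i))

/-- If all components share the same locations, the signature of a mixture is the push-forward
of the mixture under the signature map. -/
theorem FinMixture.signature_const {E : Type*} [NormedAddCommGroup E] [MeasurableSpace E]
    [BorelSpace E] {M : ℕ} (m : FinMixture E M) (c : ℕ → E) (N : ℕ) :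
    m.signature (fun _ => c) (fun _ => N) = m.toMeasure.map (signatureMap c N) := by
  have hm : Measurable (signatureMap c N) := (SimpleFunc.nearestPt c N).measurable
  ext s hs
  simp [FinMixture.signature, FinMixture.toMeasure, Measure.map_apply hm hs]

/-! ### Stochastic neural networks on `D` input points -/

/-- The joint state of a layer with `a` neurons on `D` input points, i.e. `D` vectors of `ℝ^a`
stacked in `ℝ^(D a)` with the Euclidean norm. -/
abbrev State (D a : ℕ) : Type := EuclideanSpace ℝ (Fin D × Fin a)

/-- Parameters `(W, b)` of an affine layer from `a` to `b` neurons: `W` is a `b × a` matrix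
(given by its entries) and `b` a vector. -/
abbrev Params (a b : ℕ) : Type := (Fin b → Fin a → ℝ) × EuclideanSpace ℝ (Fin b)

/-- The spectral norm of a matrix, as an extended nonnegative real. -/
def specNorm {a b : ℕ} (W : Fin b → Fin a → ℝ) : ℝ≥0∞ :=
  ‖(Matrix.toLpLin 2 2 (Matrix.of W) :
    EuclideanSpace ℝ (Fin a) →ₗ[ℝ] EuclideanSpace ℝ (Fin b)).toContinuousLinearMap‖ₑ

/-- The vectors `x 0, …, x (D - 1)`, stacked. -/
def stack {D a : ℕ} (x : Fin D → EuclideanSpace ℝ (Fin a)) : State D a :=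
  WithLp.toLp 2 fun ij => x ij.1 ij.2

/-- The `d`-th vector of a stack. -/
def unstack {D a : ℕ} (z : State D a) (d : Fin D) : EuclideanSpace ℝ (Fin a) :=
  WithLp.toLp 2 fun j => z (d, j)

/-- The affine map `z ↦ W z + b`. -/
def affine {a b : ℕ} (w : Params a b) (z : EuclideanSpace ℝ (Fin a)) :
    EuclideanSpace ℝ (Fin b) :=
  Matrix.toLpLin 2 2 (Matrix.of w.1) z + w.2

/-- The same affine map (same weights and biases), applied to each of the `D` points. -/
def affineStack {D a b : ℕ} (w : Params a b) (z : State D a) : State D b :=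
  stack fun d => affine w (unstack z d)

/-- The same activation map, applied to each of the `D` points. -/
def actStack {D a : ℕ} (f : EuclideanSpace ℝ (Fin a) → EuclideanSpace ℝ (Fin a))
    (z : State D a) : State D a :=
  stack fun d => f (unstack z d)

/-- The layer states of the network on the inputs `x 0, …, x (D - 1)`: at `0` the inputs, at `1`
the affine layer `w 0` of the inputs, and at `k + 1` (for `1 ≤ k ≤ K`) the affine layer `w k` of
the activations of the state at `k`. Here `n k` is the width of layer `k`. -/
def layerState {D K : ℕ} (n : ℕ → ℕ)
    (σ : ∀ k, EuclideanSpace ℝ (Fin (n k)) → EuclideanSpace ℝ (Fin (n k)))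
    (x : Fin D → EuclideanSpace ℝ (Fin (n 0)))
    (w : ∀ k : Fin (K + 1), Params (n k) (n (k + 1))) :
    (k : ℕ) → k ≤ K + 1 → State D (n k)
  | 0, _ => stack x
  | 1, h => affineStack (w ⟨0, h⟩) (stack x)
  | k + 2, h =>
      affineStack (w ⟨k + 1, h⟩)
        (actStack (σ (k + 1)) (layerState n σ x w (k + 1) (Nat.le_of_succ_le h)))

/-- The joint output distribution of the stochastic neural network with `K` hidden layers: the
law of the stacked network outputs when the layer parameters `w 0, …, w K` are independent with
`w k ∼ p k`. -/
def snnLaw {D : ℕ} (K : ℕ) (n : ℕ → ℕ)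
    (σ : ∀ k, EuclideanSpace ℝ (Fin (n k)) → EuclideanSpace ℝ (Fin (n k)))
    (p : ∀ k : ℕ, Measure (Params (n k) (n (k + 1))))
    (x : Fin D → EuclideanSpace ℝ (Fin (n 0))) : Measure (State D (n (K + 1))) :=
  (Measure.pi fun k : Fin (K + 1) => p k).map
    fun w => layerState n σ x w (K + 1) le_rfl

/-! ### The mixture approximation -/

/-- The approximate joint laws `q k` of the layer states. `q 1` is the law of the first affine
layer. For `k ≥ 1`, the law `q k` is compressed to a mixture `R k (q k)`, the mixture is replaced
by its signature with the locations `c k`, and `q (k + 1)` is the expectation, over `z` with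
the signature as its law, of the law of the affine layer `w ∼ p k` at the activations of `z`. -/
def approxLaw {D : ℕ} (n : ℕ → ℕ)
    (σ : ∀ k, EuclideanSpace ℝ (Fin (n k)) → EuclideanSpace ℝ (Fin (n k)))
    (p : ∀ k : ℕ, Measure (Params (n k) (n (k + 1))))
    (x : Fin D → EuclideanSpace ℝ (Fin (n 0)))
    (M : ℕ → ℕ)
    (R : ∀ k, Measure (State D (n k)) → FinMixture (State D (n k)) (M k))
    (c : ∀ k, Fin (M k) → ℕ → State D (n k)) (N : ∀ k, Fin (M k) → ℕ) :
    (k : ℕ) → Measure (State D (n k))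
  | 0 => Measure.dirac (stack x)
  | 1 => (p 0).map fun w => affineStack w (stack x)
  | k + 2 =>
      ((R (k + 1) (approxLaw n σ p x M R c N (k + 1))).signature (c (k + 1)) (N (k + 1))).bind
        fun z => (p (k + 1)).map fun w => affineStack w (actStack (σ (k + 1)) z)

/-- The recursive error bound: `Ŵ 1 = 0` and
`Ŵ (k + 1) = S k * (L * Ŵ k + L * WR k + WΔ k)` for `k ≥ 1` (index `0` is a dummy). -/
def errorBound (L : ℝ≥0) (S WR WΔ : ℕ → ℝ≥0) : ℕ → ℝ≥0
  | 0 => 0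
  | 1 => 0
  | k + 2 =>
      S (k + 1) * (L * errorBound L S WR WΔ (k + 1) + L * WR (k + 1) + WΔ (k + 1))

end SNN

end

/-!
Both laws evolve layer by layer through the same random map `z ↦ affineStack w (actStack σ z)`, with
`w` independent of `z`, and the bound is an induction on the layers.

For the network this is the Markov property `map_layerState_succ`: the state of a layer depends only
on the parameters of the earlier layers, so under the product measure it is independent of the
parameters of the next one. For the approximation it is the definition of `approxLaw`, rewritten as
a push-forward of a product measure in `approxLaw_succ`, the input now being the signature of the
compressed law.

The recursion for the error (`wasserstein_layer_le`) rests on two properties of the Wasserstein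
distance. An independent random map with random Lipschitz constant `A` expands it at most by
`𝔼[A ^ ρ] ^ (1 / ρ)` (`wasserstein_map_prod_le`), since the same realization of the map can be
applied to both components of a coupling. A layer acts on each of the `D` points separately, so
it is Lipschitz with the spectral norm of its weights, hence with `A = √D ‖W‖`, the quantity whose
moment is assumed to be bounded. The remaining distance between the two activated inputs is split by
the triangle inequality (`wasserstein_triangle`), whose proof glues couplings along their common
marginal by disintegration and then applies Minkowski's inequality.

For Gaussian parameters, the signature is a finite combination of Dirac masses, so the approximate
law is a finite mixture of laws of `affineStack w z` with `z` fixed (`FinMixture.bind_signature`).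
These are Gaussian because `w ↦ affineStack w z` is linear.
-/

namespace SNN

/-! ### Couplings and the Wasserstein distance -/

section Wasserstein

variable {E F Ω : Type*} [NormedAddCommGroup E] [MeasurableSpace E]
  [NormedAddCommGroup F] [MeasurableSpace F] [MeasurableSpace Ω] {ρ : ℝ}

lemma wasserstein_le_of_coupling {μ ν : Measure E} {γ : Measure (E × E)}
    (h₁ : γ.fst = μ) (h₂ : γ.snd = ν) :
    wasserstein ρ μ ν ≤ (∫⁻ z, ‖z.1 - z.2‖ₑ ^ ρ ∂γ) ^ (1 / ρ) :=
  iInf₂_le γ ⟨h₁, h₂⟩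

lemma wasserstein_self [BorelSpace E] [SecondCountableTopology E] (hρ : 0 < ρ) (μ : Measure E) :
    wasserstein ρ μ μ = 0 := by
  have hd : Measurable fun x : E => (x, x) := by fun_prop
  have hm : Measurable fun z : E × E => ‖z.1 - z.2‖ₑ ^ ρ := by fun_prop
  refine le_antisymm ((wasserstein_le_of_coupling (γ := μ.map fun x => (x, x)) ?_ ?_).trans ?_)
    zero_le
  · rw [Measure.fst, Measure.map_map measurable_fst hd]
    exact Measure.map_id
  · rw [Measure.snd, Measure.map_map measurable_snd hd]
    exact Measure.map_id
  · rw [lintegral_map hm hd]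
    simp [hρ]

/-- Two couplings with a common marginal on `Y` can be glued: disintegrate both along it and take
the conditionally independent product. -/
lemma exists_gluing {X Y Z : Type*} [MeasurableSpace X] [MeasurableSpace Y] [MeasurableSpace Z]
    [StandardBorelSpace X] [Nonempty X] [StandardBorelSpace Z] [Nonempty Z]
    (γ₁ : Measure (X × Y)) (γ₂ : Measure (Y × Z)) [IsFiniteMeasure γ₁] [IsFiniteMeasure γ₂]
    (h : γ₁.snd = γ₂.fst) :
    ∃ θ : Measure (Y × X × Z),
      θ.map (fun t => (t.2.1, t.1)) = γ₁ ∧ θ.map (fun t => (t.1, t.2.2)) = γ₂ := by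
  set κ := (γ₁.map Prod.swap).condKernel
  set η := γ₂.condKernel
  have hκ : γ₂.fst ⊗ₘ κ = γ₁.map Prod.swap := by
    rw [← h, ← Measure.fst_map_swap]
    exact Measure.disintegrate _ _
  have hη : γ₂.fst ⊗ₘ η = γ₂ := Measure.disintegrate _ _
  refine ⟨γ₂.fst ⊗ₘ (κ ×ₖ η), ?_, ?_⟩
  · have : (γ₂.fst ⊗ₘ (κ ×ₖ η)).map (Prod.map id Prod.fst) = γ₁.map Prod.swap := by
      rw [← Measure.compProd_map measurable_fst, ← Kernel.fst_eq, Kernel.fst_prod, hκ]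
    calc _ = ((γ₂.fst ⊗ₘ (κ ×ₖ η)).map (Prod.map id Prod.fst)).map Prod.swap := by
          rw [Measure.map_map measurable_swap (by fun_prop)]; rfl
      _ = γ₁ := by
          rw [this, Measure.map_map measurable_swap measurable_swap]
          simp
  · have : (γ₂.fst ⊗ₘ (κ ×ₖ η)).map (Prod.map id Prod.snd) = γ₂ := by
      rw [← Measure.compProd_map measurable_snd, ← Kernel.snd_eq, Kernel.snd_prod, hη]
    exact this

/-- The triangle inequality: glue the two couplings and apply Minkowski's inequality. -/
lemma wasserstein_triangle [BorelSpace E] [SecondCountableTopology E] [CompleteSpace E]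
    (hρ : 1 ≤ ρ) (μ ν η : Measure E) [IsFiniteMeasure μ] [IsFiniteMeasure ν] :
    wasserstein ρ μ η ≤ wasserstein ρ μ ν + wasserstein ρ ν η := by
  have hm : Measurable fun z : E × E => ‖z.1 - z.2‖ₑ ^ ρ := by fun_prop
  unfold wasserstein
  refine ENNReal.le_iInf₂_add_iInf₂ ?_
  rintro γ₁ ⟨h₁, h₁'⟩ γ₂ ⟨h₂, h₂'⟩
  have : IsFiniteMeasure γ₁ := ⟨by
    rw [← Measure.fst_univ, h₁]; exact measure_lt_top μ _⟩
  have : IsFiniteMeasure γ₂ := ⟨by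
    rw [← Measure.fst_univ, h₂]; exact measure_lt_top ν _⟩
  obtain ⟨θ, hθ₁, hθ₂⟩ := exists_gluing γ₁ γ₂ (h₁'.trans h₂.symm)
  refine (wasserstein_le_of_coupling (γ := θ.map Prod.snd) ?_ ?_).trans ?_
  · rw [← h₁, ← hθ₁, Measure.fst, Measure.fst, Measure.map_map (by fun_prop) (by fun_prop),
      Measure.map_map (by fun_prop) (by fun_prop)]
    rfl
  · rw [← h₂', ← hθ₂, Measure.snd, Measure.snd, Measure.map_map (by fun_prop) (by fun_prop),
      Measure.map_map (by fun_prop) (by fun_prop)]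
    rfl
  · rw [← hθ₁, ← hθ₂, lintegral_map hm (by fun_prop), lintegral_map hm (by fun_prop),
      lintegral_map hm (by fun_prop)]
    refine le_trans ?_ (ENNReal.lintegral_Lp_add_le (by fun_prop) (by fun_prop) hρ)
    gcongr with t
    calc ‖t.2.1 - t.2.2‖ₑ = ‖(t.2.1 - t.1) + (t.1 - t.2.2)‖ₑ := by congr 1; abel
      _ ≤ _ := enorm_add_le _ _

/-- An independent random map which is Lipschitz with random constant `A` expands the Wasserstein
distance at most by the `ρ`-th moment of `A`: apply the same realization of the map to both
components of a coupling. -/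
lemma wasserstein_map_prod_le [BorelSpace E] [SecondCountableTopology E]
    [BorelSpace F] [SecondCountableTopology F] (hρ : 0 < ρ)
    (μ ν : Measure E) [IsProbabilityMeasure μ] [IsProbabilityMeasure ν]
    (p : Measure Ω) [IsProbabilityMeasure p] {f : E × Ω → F} (hf : Measurable f)
    {A : Ω → ℝ≥0∞} (hA : Measurable A)
    (hfA : ∀ z z' w, ‖f (z, w) - f (z', w)‖ₑ ≤ A w * ‖z - z'‖ₑ)
    (hfin : (∫⁻ w, A w ^ ρ ∂p) ^ (1 / ρ) ≠ ∞) :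
    wasserstein ρ ((μ.prod p).map f) ((ν.prod p).map f) ≤
      (∫⁻ w, A w ^ ρ ∂p) ^ (1 / ρ) * wasserstein ρ μ ν := by
  have hm : Measurable fun z : F × F => ‖z.1 - z.2‖ₑ ^ ρ := by fun_prop
  have hne : Nonempty {γ : Measure (E × E) | γ.fst = μ ∧ γ.snd = ν} :=
    ⟨μ.prod ν, Measure.fst_prod, Measure.snd_prod⟩
  have hW : wasserstein ρ μ ν = ⨅ γ : {γ : Measure (E × E) | γ.fst = μ ∧ γ.snd = ν},
      (∫⁻ z, ‖z.1 - z.2‖ₑ ^ ρ ∂γ.1) ^ (1 / ρ) := (iInf_subtype'' _ _).symm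
  rw [hW, ENNReal.mul_iInf' (fun h => absurd h hfin) fun _ => hne]
  refine le_iInf ?_
  rintro ⟨γ, h₁, h₂⟩
  have : IsFiniteMeasure γ := ⟨by rw [← Measure.fst_univ, h₁]; exact measure_lt_top μ _⟩
  have hg : Measurable fun t : (E × E) × Ω => (f (t.1.1, t.2), f (t.1.2, t.2)) := by fun_prop
  refine (wasserstein_le_of_coupling
    (γ := (γ.prod p).map fun t => (f (t.1.1, t.2), f (t.1.2, t.2))) ?_ ?_).trans ?_
  · rw [Measure.fst, Measure.map_map measurable_fst hg, ← h₁, Measure.fst]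
    nth_rw 2 [← Measure.map_id (μ := p)]
    rw [Measure.map_prod_map _ _ measurable_fst measurable_id, Measure.map_map hf (by fun_prop)]
    rfl
  · rw [Measure.snd, Measure.map_map measurable_snd hg, ← h₂, Measure.snd]
    nth_rw 2 [← Measure.map_id (μ := p)]
    rw [Measure.map_prod_map _ _ measurable_snd measurable_id, Measure.map_map hf (by fun_prop)]
    rfl
  · rw [lintegral_map hm hg, ← ENNReal.mul_rpow_of_nonneg _ _ (by positivity), mul_comm,
      ← lintegral_prod_mul (by fun_prop) (by fun_prop)]
    gcongr with t
    rw [← ENNReal.mul_rpow_of_nonneg _ _ hρ.le, mul_comm]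
    gcongr
    exact hfA _ _ _

lemma wasserstein_map_le [BorelSpace E] [SecondCountableTopology E]
    [BorelSpace F] [SecondCountableTopology F] (hρ : 0 < ρ)
    (μ ν : Measure E) [IsProbabilityMeasure μ] [IsProbabilityMeasure ν]
    {f : E → F} {L : ℝ≥0} (hf : LipschitzWith L f) :
    wasserstein ρ (μ.map f) (ν.map f) ≤ L * wasserstein ρ μ ν := by
  have hfm : Measurable f := hf.continuous.measurable
  have key (μ : Measure E) [IsProbabilityMeasure μ] :
      (μ.prod (Measure.dirac ())).map (fun t : E × Unit => f t.1) = μ.map f := by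
    conv_rhs => rw [← Measure.fst_prod (μ := μ) (ν := Measure.dirac ()), Measure.fst]
    rw [Measure.map_map hfm measurable_fst]
    rfl
  have hL : (∫⁻ _, (L : ℝ≥0∞) ^ ρ ∂(Measure.dirac ())) ^ (1 / ρ) = L := by
    rw [lintegral_const, measure_univ, mul_one, ← ENNReal.rpow_mul, mul_one_div_cancel hρ.ne',
      ENNReal.rpow_one]
  have := wasserstein_map_prod_le hρ μ ν (Measure.dirac ()) (f := fun t : E × Unit => f t.1)
    (A := fun _ => L) (by fun_prop) measurable_const
    (fun z z' _ => by simpa only [edist_eq_enorm_sub] using hf z z') (by rw [hL]; simp)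
  rwa [key, key, hL] at this

end Wasserstein

/-! ### Lipschitz bounds and measurability of the layers -/

section Network

variable {D a b : ℕ}

lemma affineStack_apply (w : Params a b) (z : State D a) (d : Fin D) (i : Fin b) :
    affineStack w z (d, i) = ∑ j, w.1 i j * z (d, j) + w.2 i := by
  simp [affineStack, stack, unstack, affine, Matrix.toLpLin_apply, Matrix.mulVec, dotProduct]

lemma continuous_affineStack :
    Continuous fun t : State D a × Params a b => affineStack t.2 t.1 := by
  refine (PiLp.continuous_toLp 2 _).comp (continuous_pi fun ij => ?_)
  change Continuous fun t : State D a × Params a b => affineStack t.2 t.1 (ij.1, ij.2)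
  simp only [affineStack_apply]
  fun_prop

lemma continuous_affineStack_const (z : State D a) :
    Continuous fun w : Params a b => affineStack w z := by
  refine (PiLp.continuous_toLp 2 _).comp (continuous_pi fun ij => ?_)
  change Continuous fun w : Params a b => affineStack w z (ij.1, ij.2)
  simp only [affineStack_apply]
  fun_prop

lemma measurable_affineStack_const (z : State D a) :
    Measurable fun w : Params a b => affineStack w z :=
  (continuous_affineStack_const z).measurable

lemma norm_sq_eq_sum_unstack (z : State D a) : ‖z‖ ^ 2 = ∑ d, ‖unstack z d‖ ^ 2 := by
  simp [EuclideanSpace.norm_sq_eq, Fintype.sum_prod_type, unstack]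

/-- A blockwise estimate with constant `C` holds with the same constant for the stacks. -/
lemma norm_stack_sub_le {C : ℝ} (hC : 0 ≤ C)
    {f : EuclideanSpace ℝ (Fin a) → EuclideanSpace ℝ (Fin b)}
    (hf : ∀ x y, ‖f x - f y‖ ≤ C * ‖x - y‖) (z z' : State D a) :
    ‖stack (fun d => f (unstack z d)) - stack (fun d => f (unstack z' d))‖ ≤ C * ‖z - z'‖ := by
  refine le_of_sq_le_sq ?_ (by positivity)
  rw [mul_pow, norm_sq_eq_sum_unstack, norm_sq_eq_sum_unstack, Finset.mul_sum]
  refine Finset.sum_le_sum fun d _ => ?_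
  rw [← mul_pow]
  exact pow_le_pow_left₀ (norm_nonneg _) (hf (unstack z d) (unstack z' d)) 2

lemma lipschitzWith_actStack {L : ℝ≥0} {f : EuclideanSpace ℝ (Fin a) → EuclideanSpace ℝ (Fin a)}
    (hf : LipschitzWith L f) : LipschitzWith L (actStack f : State D a → State D a) :=
  LipschitzWith.of_dist_le_mul fun z z' => by
    rw [dist_eq_norm, dist_eq_norm]
    exact norm_stack_sub_le L.coe_nonneg
      (fun x y => by simpa only [dist_eq_norm] using hf.dist_le_mul x y) z z'

lemma enorm_affineStack_sub_le (w : Params a b) (z z' : State D a) :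
    ‖affineStack w z - affineStack w z'‖ₑ ≤ specNorm w.1 * ‖z - z'‖ₑ := by
  set T := (Matrix.toLpLin 2 2 (Matrix.of w.1) :
    EuclideanSpace ℝ (Fin a) →ₗ[ℝ] EuclideanSpace ℝ (Fin b)).toContinuousLinearMap with hT
  have key : ‖affineStack w z - affineStack w z'‖ ≤ ‖T‖ * ‖z - z'‖ := by
    refine norm_stack_sub_le (norm_nonneg _) (fun x y => ?_) z z'
    calc ‖affine w x - affine w y‖ = ‖T (x - y)‖ := by
          rw [map_sub]; simp [affine, hT]
      _ ≤ _ := T.le_opNorm _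
  rw [specNorm, ← hT, ← ofReal_norm, ← ofReal_norm, ← ofReal_norm,
    ← ENNReal.ofReal_mul (norm_nonneg _)]
  exact ENNReal.ofReal_le_ofReal key

lemma measurable_specNorm : Measurable (specNorm : (Fin b → Fin a → ℝ) → ℝ≥0∞) := by
  let Φ : (Fin b → Fin a → ℝ) →ₗ[ℝ] EuclideanSpace ℝ (Fin a) →L[ℝ] EuclideanSpace ℝ (Fin b) :=
    LinearMap.toContinuousLinearMap.toLinearMap ∘ₗ (Matrix.toLpLin 2 2).toLinearMap ∘ₗ
      (Matrix.ofLinearEquiv ℝ).toLinearMap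
  have hΦ : Continuous Φ := Φ.continuous_of_finiteDimensional
  exact hΦ.enorm.measurable

end Network

/-! ### Mixtures and signatures are probability measures -/

section Signature

variable {E : Type*} [NormedAddCommGroup E] [MeasurableSpace E] {M : ℕ}

instance FinMixture.isProbabilityMeasure_toMeasure (m : FinMixture E M) :
    IsProbabilityMeasure m.toMeasure :=
  ⟨by simp [FinMixture.toMeasure, ← ENNReal.ofNNReal_finsetSum, m.weight_sum]⟩

variable [BorelSpace E]

lemma measurable_signatureMap (c : ℕ → E) (N : ℕ) : Measurable (signatureMap c N) :=
  (SimpleFunc.nearestPt c N).measurable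

instance FinMixture.isProbabilityMeasure_signature (m : FinMixture E M) (c : Fin M → ℕ → E)
    (N : Fin M → ℕ) : IsProbabilityMeasure (m.signature c N) :=
  ⟨by
    simp [FinMixture.signature, Measure.map_apply (measurable_signatureMap _ _) MeasurableSet.univ,
      ← ENNReal.ofNNReal_finsetSum, m.weight_sum]⟩

end Signature

/-! ### Recursion for the laws of the layers -/

section Laws

/-- Under a product measure, the coordinate `i` is independent of any function of the coordinates
in a set not containing `i`. -/
lemma map_prodMk_eval_pi {ι Y : Type*} [Fintype ι] {X : ι → Type*} [∀ i, MeasurableSpace (X i)]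
    [MeasurableSpace Y] (p : ∀ i, Measure (X i)) [∀ i, IsProbabilityMeasure (p i)]
    {g : (∀ i, X i) → Y} (hg : Measurable g) {s : Finset ι} (hgs : DependsOn g s)
    {i : ι} (hi : i ∉ s) :
    (Measure.pi p).map (fun w => (g w, w i)) = ((Measure.pi p).map g).prod (p i) := by
  classical
  obtain ⟨w₀⟩ : Nonempty (∀ i, X i) := (Measure.pi p).nonempty_of_neZero
  -- `g` factors through the restriction to `s`, other coordinates being filled in from `w₀`
  let e : (∀ j : s, X j) → ∀ j, X j := fun v j => if h : j ∈ s then v ⟨j, h⟩ else w₀ j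
  have he : Measurable e := by
    refine measurable_pi_lambda _ fun j => ?_
    by_cases h : j ∈ s
    · simpa only [e, h, dite_true] using measurable_pi_apply (⟨j, h⟩ : s)
    · simp only [e, h, dite_false, measurable_const]
  have hge : g = fun w => g (e fun j => w j) := by
    funext w
    refine hgs fun j hj => ?_
    simp only [e, dif_pos (Finset.mem_coe.1 hj)]
  have hind := (iIndepFun_pi (μ := p) (X := fun _ => id) fun _ => aemeasurable_id).indepFun_finset
    s {i} (by simpa using hi) fun j => measurable_pi_apply j
  have hind' : IndepFun g (fun w => w i) (Measure.pi p) := by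
    rw [hge]
    exact hind.comp (φ := fun v => g (e v))
      (ψ := fun v : ∀ j : ({i} : Finset ι), X j => v ⟨i, Finset.mem_singleton_self i⟩)
      (hg.comp he) (measurable_pi_apply _)
  rw [(indepFun_iff_map_prod_eq_prod_map_map hg.aemeasurable
    (measurable_pi_apply i).aemeasurable).1 hind', (measurePreserving_eval p i).map_eq]

lemma measurable_map_of_measurable_uncurry {E F Ω : Type*} [MeasurableSpace E]
    [MeasurableSpace F] [MeasurableSpace Ω] (p : Measure Ω) [SFinite p] {f : E → Ω → F}
    (hf : Measurable f.uncurry) : Measurable fun z => p.map (f z) := by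
  have hfz (z : E) : Measurable (f z) := hf.comp measurable_prodMk_left
  refine Measure.measurable_of_measurable_coe _ fun s hs => ?_
  simp only [Measure.map_apply (hfz _) hs]
  exact measurable_measure_prodMk_left (hf hs)

lemma bind_map_eq_map_prod {E F Ω : Type*} [MeasurableSpace E] [MeasurableSpace F]
    [MeasurableSpace Ω] (μ : Measure E) [SFinite μ] (p : Measure Ω) [SFinite p]
    {f : E → Ω → F} (hf : Measurable f.uncurry) :
    μ.bind (fun z => p.map (f z)) = (μ.prod p).map f.uncurry := by
  have hfz (z : E) : Measurable (f z) := hf.comp measurable_prodMk_left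
  ext s hs
  rw [Measure.bind_apply hs (measurable_map_of_measurable_uncurry p hf).aemeasurable,
    Measure.map_apply hf hs, Measure.prod_apply (hf hs)]
  simp only [Measure.map_apply (hfz _) hs]
  rfl

variable {D K : ℕ} {n : ℕ → ℕ}
  {σ : ∀ k, EuclideanSpace ℝ (Fin (n k)) → EuclideanSpace ℝ (Fin (n k))} {L : ℝ≥0}
  {p : ∀ k : ℕ, Measure (Params (n k) (n (k + 1)))}
  {x : Fin D → EuclideanSpace ℝ (Fin (n 0))}

lemma measurable_affineStack_actStack {a b : ℕ}
    {f : EuclideanSpace ℝ (Fin a) → EuclideanSpace ℝ (Fin a)} (hf : LipschitzWith L f) :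
    Measurable (Function.uncurry fun (z : State D a) (w : Params a b) =>
      affineStack w (actStack f z)) :=
  (continuous_affineStack.comp
    (((lipschitzWith_actStack hf).continuous.comp continuous_fst).prodMk
      continuous_snd)).measurable

/-- The state of layer `k` is a function of the parameters of the layers before `k` only. -/
lemma dependsOn_layerState (k : ℕ) (h : k ≤ K + 1) :
    DependsOn (fun w : ∀ k : Fin (K + 1), Params (n k) (n (k + 1)) => layerState n σ x w k h)
      (Finset.univ.filter fun i : Fin (K + 1) => i.1 < k : Finset (Fin (K + 1))) := by
  induction k with
  | zero => exact fun _ _ _ => rfl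
  | succ k ih =>
    intro w w' hw
    have hk : w ⟨k, h⟩ = w' ⟨k, h⟩ := hw _ (by simp)
    cases k with
    | zero => simp only [layerState, hk]
    | succ k =>
      have hprev := ih (Nat.le_of_succ_le h) fun i hi => hw i (by
        simp only [Finset.coe_filter, Finset.mem_univ, true_and, Set.mem_ofPred_eq] at hi ⊢
        omega)
      simp only [layerState, hk]
      exact congrArg (fun z => affineStack (w' ⟨k + 1, h⟩) (actStack (σ (k + 1)) z)) hprev

lemma measurable_layerState (hσ : ∀ k, 1 ≤ k → k ≤ K → LipschitzWith L (σ k))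
    (k : ℕ) (h : k ≤ K + 1) :
    Measurable fun w : ∀ k : Fin (K + 1), Params (n k) (n (k + 1)) => layerState n σ x w k h := by
  induction k with
  | zero => exact measurable_const
  | succ k ih =>
    have hw : Measurable fun w : ∀ k : Fin (K + 1), Params (n k) (n (k + 1)) =>
        (w ⟨k, h⟩ : Params (n k) (n (k + 1))) := measurable_pi_apply _
    cases k with
    | zero =>
      simp only [layerState]
      exact (measurable_affineStack_const (stack x)).comp hw
    | succ k =>
      simp only [layerState]
      have hf := measurable_affineStack_actStack (D := D) (b := n (k + 1 + 1))
        (hσ (k + 1) (by omega) (by omega))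
      have := hf.comp ((ih (Nat.le_of_succ_le h)).prodMk hw)
      exact this

lemma map_layerState_one [∀ k : Fin (K + 1), IsProbabilityMeasure (p k)] (h : 1 ≤ K + 1) :
    (Measure.pi fun k : Fin (K + 1) => p k).map (fun w => layerState n σ x w 1 h) =
      (p 0).map fun w => affineStack w (stack x) := by
  have he := (measurePreserving_eval (fun k : Fin (K + 1) => p k) ⟨0, h⟩).map_eq
  have hm := Measure.map_map (μ := Measure.pi fun k : Fin (K + 1) => p k)
    (measurable_affineStack_const (b := n (0 + 1)) (stack x))
    (measurable_pi_apply (⟨0, h⟩ : Fin (K + 1)))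
  exact hm.symm.trans (congrArg (Measure.map _) he)

/-- The layer states form a Markov chain: the parameters of the next layer are independent of the
current state. -/
lemma map_layerState_succ [∀ k : Fin (K + 1), IsProbabilityMeasure (p k)]
    (hσ : ∀ k, 1 ≤ k → k ≤ K → LipschitzWith L (σ k)) (k : ℕ) (h : k + 2 ≤ K + 1) :
    (Measure.pi fun k : Fin (K + 1) => p k).map (fun w => layerState n σ x w (k + 2) h) =
      (((Measure.pi fun k : Fin (K + 1) => p k).map
        fun w => layerState n σ x w (k + 1) (Nat.le_of_succ_le h)).prod (p (k + 1))).map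
        (Function.uncurry fun z w => affineStack w (actStack (σ (k + 1)) z)) := by
  have hm := measurable_layerState (x := x) hσ (k + 1) (Nat.le_of_succ_le h)
  rw [← map_prodMk_eval_pi (fun k : Fin (K + 1) => p k) hm (dependsOn_layerState _ _)
      (i := ⟨k + 1, h⟩) (by simp),
    Measure.map_map (measurable_affineStack_actStack (hσ (k + 1) (by omega) (by omega)))
      (hm.prodMk (measurable_pi_apply _))]
  rfl

variable {M : ℕ → ℕ} {R : ∀ k, Measure (State D (n k)) → FinMixture (State D (n k)) (M k)}
  {c : ∀ k, Fin (M k) → ℕ → State D (n k)} {N : ∀ k, Fin (M k) → ℕ}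

lemma approxLaw_succ (k : ℕ) (hσ : LipschitzWith L (σ (k + 1)))
    [SFinite (p (k + 1))] :
    approxLaw n σ p x M R c N (k + 2) =
      (((R (k + 1) (approxLaw n σ p x M R c N (k + 1))).signature (c (k + 1)) (N (k + 1))).prod
        (p (k + 1))).map
        (Function.uncurry fun z w => affineStack w (actStack (σ (k + 1)) z)) :=
  bind_map_eq_map_prod _ _ (measurable_affineStack_actStack hσ)

lemma isProbabilityMeasure_approxLaw (hσ : ∀ k, 1 ≤ k → k ≤ K → LipschitzWith L (σ k))
    (hp : ∀ k, k ≤ K → IsProbabilityMeasure (p k)) (k : ℕ) (h : k ≤ K + 1) :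
    IsProbabilityMeasure (approxLaw n σ p x M R c N k) := by
  match k with
  | 0 => exact Measure.dirac.isProbabilityMeasure
  | 1 =>
    have := hp 0 (Nat.zero_le _)
    exact Measure.isProbabilityMeasure_map (measurable_affineStack_const _).aemeasurable
  | k + 2 =>
    have := hp (k + 1) (by omega)
    have hk := hσ (k + 1) (by omega) (by omega)
    rw [approxLaw_succ k hk]
    exact Measure.isProbabilityMeasure_map (measurable_affineStack_actStack hk).aemeasurable

end Laws

/-! ### Error of one layer -/

section Step

variable {D a b : ℕ} {ρ : ℝ} {L : ℝ≥0}

/-- The layer is even `‖W‖`-Lipschitz, and the factor `√D` only loosens this bound: for `D ≥ 1` it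
is at least one, and for `D = 0` the state space is a single point. -/
lemma enorm_affineStack_sub_le_sqrt_mul (w : Params a b) (z z' : State D a) :
    ‖affineStack w z - affineStack w z'‖ₑ ≤
      ENNReal.ofReal (Real.sqrt D) * specNorm w.1 * ‖z - z'‖ₑ := by
  rcases Nat.eq_zero_or_pos D with rfl | hD
  · simp [Subsingleton.elim (affineStack w z - affineStack w z') 0]
  · refine (enorm_affineStack_sub_le w z z').trans ?_
    rw [mul_assoc]
    refine le_mul_of_one_le_left zero_le ?_
    rw [ENNReal.one_le_ofReal, Real.one_le_sqrt]
    exact_mod_cast hD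

/-- One layer of the error recursion. The input error is split by the triangle inequality along
`μ → ν → r → s`, where `r` is the compression of `ν` and `s` the signature of `r`. -/
lemma wasserstein_layer_le (hρ : 1 ≤ ρ)
    {f : EuclideanSpace ℝ (Fin a) → EuclideanSpace ℝ (Fin a)} (hf : LipschitzWith L f)
    (p : Measure (Params a b)) [IsProbabilityMeasure p] (μ ν r s : Measure (State D a))
    [IsProbabilityMeasure μ] [IsProbabilityMeasure ν] [IsProbabilityMeasure r]
    [IsProbabilityMeasure s] {S W WR WΔ : ℝ≥0}
    (hS : ENNReal.ofReal (Real.sqrt D) * (∫⁻ w, specNorm w.1 ^ ρ ∂p) ^ (1 / ρ) ≤ S)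
    (hW : wasserstein ρ μ ν ≤ W) (hR : wasserstein ρ ν r ≤ WR)
    (hΔ : wasserstein ρ (r.map (actStack f)) (s.map (actStack f)) ≤ WΔ) :
    wasserstein ρ
        ((μ.prod p).map (Function.uncurry fun z w => affineStack w (actStack f z)))
        ((s.prod p).map (Function.uncurry fun z w => affineStack w (actStack f z))) ≤
      S * (L * W + L * WR + WΔ) := by
  have hρ0 : 0 < ρ := by linarith
  have hact := lipschitzWith_actStack (D := D) hf
  have hactm := hact.continuous.measurable
  have hprob (μ : Measure (State D a)) [IsProbabilityMeasure μ] :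
      IsProbabilityMeasure (μ.map (actStack f)) :=
    Measure.isProbabilityMeasure_map hactm.aemeasurable
  have := hprob μ
  have := hprob ν
  have := hprob r
  have := hprob s
  have hin : wasserstein ρ (μ.map (actStack f)) (s.map (actStack f)) ≤
      L * W + L * WR + WΔ :=
    calc _ ≤ wasserstein ρ (μ.map (actStack f)) (r.map (actStack f)) +
          wasserstein ρ (r.map (actStack f)) (s.map (actStack f)) :=
        wasserstein_triangle hρ _ _ _
      _ ≤ wasserstein ρ (μ.map (actStack f)) (ν.map (actStack f)) +
          wasserstein ρ (ν.map (actStack f)) (r.map (actStack f)) + WΔ :=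
        add_le_add (wasserstein_triangle hρ _ _ _) hΔ
      _ ≤ _ := by
        gcongr
        · exact (wasserstein_map_le hρ0 μ ν hact).trans (by gcongr)
        · exact (wasserstein_map_le hρ0 ν r hact).trans (by gcongr)
  have hA : (∫⁻ w : Params a b, (ENNReal.ofReal (Real.sqrt D) * specNorm w.1) ^ ρ ∂p) ^ (1 / ρ)
      ≤ S := by
    refine le_trans (le_of_eq ?_) hS
    simp_rw [ENNReal.mul_rpow_of_nonneg _ _ hρ0.le]
    have hm : Measurable fun w : Params a b => specNorm w.1 ^ ρ :=
      (measurable_specNorm.comp measurable_fst).pow_const ρ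
    rw [lintegral_const_mul _ hm,
      ENNReal.mul_rpow_of_nonneg _ _ (by positivity), ← ENNReal.rpow_mul,
      mul_one_div_cancel hρ0.ne', ENNReal.rpow_one]
  have hout (μ : Measure (State D a)) [IsProbabilityMeasure μ] :
      (μ.prod p).map (Function.uncurry fun z w => affineStack w (actStack f z)) =
        ((μ.map (actStack f)).prod p).map fun t => affineStack (b := b) t.2 t.1 := by
    conv_rhs => rw [← Measure.map_id (μ := p)]
    rw [Measure.map_prod_map _ _ hactm measurable_id,
      Measure.map_map continuous_affineStack.measurable (hactm.prodMap measurable_id)]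
    rfl
  rw [hout μ, hout s]
  refine (wasserstein_map_prod_le hρ0 _ _ p continuous_affineStack.measurable
    (A := fun w => ENNReal.ofReal (Real.sqrt D) * specNorm w.1)
    ((measurable_specNorm.comp measurable_fst).const_mul _)
    (fun z z' w => enorm_affineStack_sub_le_sqrt_mul w z z')
    (hA.trans_lt ENNReal.coe_lt_top).ne).trans ?_
  exact mul_le_mul' hA hin

end Step

/-! ### Gaussian mixtures -/

section Gaussian

/-- The weights sum to one because the combination has total mass one. -/
lemma isGaussianMixture_sum {E ι : Type*} [TopologicalSpace E] [AddCommMonoid E] [Module ℝ E]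
    [MeasurableSpace E] [Fintype ι] (π : ι → ℝ≥0) (g : ι → Measure E)
    (hg : ∀ i, IsGaussian (g i)) (h : IsProbabilityMeasure (∑ i, π i • g i)) :
    IsGaussianMixture (∑ i, π i • g i) := by
  have e := (Fintype.equivFin ι).symm
  refine ⟨Fintype.card ι, ⟨fun j => π (e j), ?_, fun j => ⟨g (e j), inferInstance⟩⟩,
    fun j => hg (e j), (e.sum_comp fun i => π i • g i).symm⟩
  have h1 : ∑ i, (π i : ℝ≥0∞) = 1 := by
    rw [← h.measure_univ, Measure.finsetSum_apply]
    exact Finset.sum_congr rfl fun i _ => by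
      rw [Measure.smul_apply, measure_univ, ENNReal.smul_def, smul_eq_mul, mul_one]
  rw [e.sum_comp]
  exact_mod_cast h1

/-- At a fixed input, the output of an affine layer is linear in its parameters. -/
lemma isGaussian_map_affineStack {D a b : ℕ} (p : Measure (Params a b)) [IsGaussian p]
    (z : State D a) : IsGaussian (p.map fun w => affineStack w z) := by
  let T : Params a b →L[ℝ] State D b :=
    { toFun := fun w => affineStack w z
      map_add' := fun w w' => by
        ext ⟨d, i⟩
        simp only [affineStack_apply, PiLp.add_apply, Prod.fst_add, Prod.snd_add, Pi.add_apply,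
          add_mul, Finset.sum_add_distrib]
        ring
      map_smul' := fun r w => by
        ext ⟨d, i⟩
        simp only [affineStack_apply, PiLp.smul_apply, Prod.smul_fst, Prod.smul_snd, Pi.smul_apply,
          smul_eq_mul, RingHom.id_apply, mul_add, Finset.mul_sum, mul_assoc]
      cont := continuous_affineStack_const z }
  exact isGaussian_map_of_measurable (L := T) (measurable_affineStack_const z)

/-- A signature is finitely supported, so that averaging a kernel over it is a finite sum. -/
lemma FinMixture.bind_signature {E F : Type*} [NormedAddCommGroup E] [MeasurableSpace E]
    [BorelSpace E] [MeasurableSpace F] {M : ℕ} (m : FinMixture E M) (c : Fin M → ℕ → E)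
    (N : Fin M → ℕ) {κ : E → Measure F} (hκ : Measurable κ) :
    (m.signature c N).bind κ =
      ∑ t : Σ i, (SimpleFunc.nearestPt (c i) (N i)).range,
        (m.weight t.1 *
          ((m.comp t.1 : Measure E) (signatureMap (c t.1) (N t.1) ⁻¹' {t.2.1})).toNNReal) •
          κ t.2 := by
  ext s hs
  have hκs : Measurable fun z => κ z s := (Measure.measurable_coe hs).comp hκ
  rw [Measure.bind_apply hs hκ.aemeasurable, FinMixture.signature, lintegral_finsetSum_measure,
    Measure.finsetSum_apply, Fintype.sum_sigma]
  refine Finset.sum_congr rfl fun i _ => ?_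
  have hsimple : ∫⁻ z, κ (signatureMap (c i) (N i) z) s ∂(m.comp i : Measure E) =
      ∑ y ∈ (SimpleFunc.nearestPt (c i) (N i)).range,
        κ y s * (m.comp i : Measure E) (signatureMap (c i) (N i) ⁻¹' {y}) := by
    rw [signatureMap, ← SimpleFunc.map_lintegral (fun y => κ y s),
      ← SimpleFunc.lintegral_eq_lintegral]
    rfl
  rw [lintegral_smul_measure, lintegral_map hκs (measurable_signatureMap _ _), hsimple,
    ← Finset.sum_coe_sort, Finset.smul_sum]
  refine Finset.sum_congr rfl fun y _ => ?_
  simp only [Measure.smul_apply, ENNReal.smul_def, smul_eq_mul, ENNReal.coe_mul,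
    ENNReal.coe_toNNReal (measure_ne_top _ _)]
  ring

end Gaussian

end SNN

theorem mainTheorem2
    (ρ : ℝ) (hρ : ρ = 1 ∨ ρ = 2)
    (D K : ℕ) (n : ℕ → ℕ)
    (σ : ∀ k, EuclideanSpace ℝ (Fin (n k)) → EuclideanSpace ℝ (Fin (n k)))
    (L : ℝ≥0) (hσ : ∀ k, 1 ≤ k → k ≤ K → LipschitzWith L (σ k))
    (p : ∀ k : ℕ, Measure (SNN.Params (n k) (n (k + 1))))
    (hp : ∀ k, k ≤ K → IsProbabilityMeasure (p k))
    (x : Fin D → EuclideanSpace ℝ (Fin (n 0)))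
    (M : ℕ → ℕ)
    (R : ∀ k, Measure (SNN.State D (n k)) → SNN.FinMixture (SNN.State D (n k)) (M k))
    (c : ∀ k, Fin (M k) → ℕ → SNN.State D (n k)) (N : ∀ k, Fin (M k) → ℕ)
    (S WR WΔ : ℕ → ℝ≥0)
    (hS : ∀ k, 1 ≤ k → k ≤ K →
      ENNReal.ofReal (Real.sqrt D) * (∫⁻ w, SNN.specNorm w.1 ^ ρ ∂(p k)) ^ (1 / ρ) ≤ S k)
    (hR : ∀ k, 1 ≤ k → k ≤ K →
      SNN.wasserstein ρ (SNN.approxLaw n σ p x M R c N k)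
        (R k (SNN.approxLaw n σ p x M R c N k)).toMeasure ≤ WR k)
    (hΔ : ∀ k, 1 ≤ k → k ≤ K →
      SNN.wasserstein ρ
        ((R k (SNN.approxLaw n σ p x M R c N k)).toMeasure.map (SNN.actStack (σ k)))
        (((R k (SNN.approxLaw n σ p x M R c N k)).signature (c k) (N k)).map
          (SNN.actStack (σ k))) ≤ WΔ k) :
    SNN.wasserstein ρ (SNN.snnLaw K n σ p x) (SNN.approxLaw n σ p x M R c N (K + 1)) ≤
        SNN.errorBound L S WR WΔ (K + 1) ∧
      ((∀ k, k ≤ K → IsGaussian (p k)) →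
        SNN.IsGaussianMixture (SNN.approxLaw n σ p x M R c N (K + 1))) := by
  have hρ1 : 1 ≤ ρ := by rcases hρ with rfl | rfl <;> norm_num
  have hpF : ∀ k : Fin (K + 1), IsProbabilityMeasure (p k) :=
    fun k => hp k (Nat.lt_succ_iff.1 k.2)
  constructor
  · suffices ∀ k (h : k + 1 ≤ K + 1),
        SNN.wasserstein ρ ((Measure.pi fun k : Fin (K + 1) => p k).map
          fun w => SNN.layerState n σ x w (k + 1) h) (SNN.approxLaw n σ p x M R c N (k + 1)) ≤
            SNN.errorBound L S WR WΔ (k + 1) from this K le_rfl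
    intro k
    induction k with
    | zero =>
      intro h
      rw [SNN.map_layerState_one]
      exact (SNN.wasserstein_self (by linarith) _).trans_le zero_le
    | succ k ih =>
      intro h
      have hk : k + 1 ≤ K := by omega
      have := hp (k + 1) hk
      have := SNN.isProbabilityMeasure_approxLaw (x := x) (R := R) (c := c) (N := N) hσ hp
        (k + 1) (by omega)
      have := Measure.isProbabilityMeasure_map
        (μ := Measure.pi fun k : Fin (K + 1) => p k)
        (SNN.measurable_layerState (x := x) hσ (k + 1) (by omega)).aemeasurable
      rw [SNN.map_layerState_succ hσ k h, SNN.approxLaw_succ k (hσ (k + 1) (by omega) hk)]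
      refine (SNN.wasserstein_layer_le hρ1 (hσ (k + 1) (by omega) hk) (p (k + 1)) _ _ _ _
        (hS (k + 1) (by omega) hk) (ih _) (hR (k + 1) (by omega) hk)
        (hΔ (k + 1) (by omega) hk)).trans (le_of_eq ?_)
      simp only [SNN.errorBound, ENNReal.coe_mul, ENNReal.coe_add]
  · intro hG
    have hprob := SNN.isProbabilityMeasure_approxLaw (x := x) (R := R) (c := c) (N := N) hσ hp
      (K + 1) le_rfl
    rcases K with _ | K
    · have := hG 0 le_rfl
      have hg := SNN.isGaussian_map_affineStack (p 0) (SNN.stack x)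
      have := SNN.isGaussianMixture_sum (fun _ : Unit => 1)
        (fun _ => (p 0).map fun w => SNN.affineStack w (SNN.stack x)) (fun _ => hg)
        (by simpa [SNN.approxLaw] using hprob)
      simpa [SNN.approxLaw] using this
    · have := hG (K + 1) le_rfl
      have hf := SNN.measurable_affineStack_actStack (D := D) (b := n (K + 1 + 1))
        (hσ (K + 1) (by omega) le_rfl)
      have hκ := SNN.measurable_map_of_measurable_uncurry (p (K + 1)) hf
      rw [SNN.approxLaw, SNN.FinMixture.bind_signature _ _ _ hκ] at hprob ⊢
      exact SNN.isGaussianMixture_sum _ _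
        (fun t => SNN.isGaussian_map_affineStack (p (K + 1)) _) hprob
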